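/- Let $G$ be a finite simple connected graph of order $n$ with independence number $\alpha$ (the maximum cardinality of a set of pairwise non-adjacent vertices), where $\alpha \ge 1$ and $n \ge 2\alpha$. For a connected graph $H$ of order $n$ write $$\mu(H) = \binom{n}{2}^{-1} \sum_{\{u,v\}\subset V(H),\, u\ne v} d_H(u,v)$$ for its average distance, where $d_H(u,v)$ is the distance between $u$ and $v$ in $H$. Then $G$ has a spanning tree $T$ with $$\mu(T) < \begin{cases} \alpha + 1 & \text{if } 1 \le \alpha \le 6,\\[2pt] \alpha + \dfrac12 + \dfrac{4(\alpha-1)}{\alpha^2} & \text{if } \alpha \ge 7. \end{cases}$$ -/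

import Mathlib

/-- The Wiener index of a finite graph: the sum of `d_G(u, v)` over all unordered pairs
`{u, v}` of distinct vertices. -/
noncomputable def SimpleGraph.wienerIndex {V : Type*} [Fintype V] [DecidableEq V] (G : SimpleGraph V) : ℕ :=
  ∑ e ∈ (Finset.univ : Finset (Sym2 V)).filter (fun e => ¬ e.IsDiag),
    Sym2.lift ⟨fun u v => G.dist u v, fun _ _ => SimpleGraph.dist_comm⟩ e

/-- The average distance of a finite graph of order `n`: the sum of the distances over all
unordered pairs of distinct vertices, divided by `n.choose 2`. -/
noncomputable def SimpleGraph.averageDistance {V : Type*} [Fintype V] [DecidableEq V]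
    (G : SimpleGraph V) : ℝ :=
  (G.wienerIndex : ℝ) / ((Fintype.card V).choose 2 : ℝ)

/-! If `D` is a connected dominating set of order m, take a tree on `D` and hang every other vertex
v as a leaf on a neighbour in `D`, its hub; vertices of `D` are their own hubs. If the hub distances
summed over ordered pairs total at most B n², with B < m, the spanning tree has average distance
below B + 2 (`IsTreeOn.exists_isTree_averageDistance_lt`). An edge of a tree separates at most n²/2
ordered pairs, so B = (m - 1)/2 always works and gives the bound (m + 3)/2.

A greedy construction (`IsGrown.exists_isDominating`) grows `D` two vertices at a time and an
independent set `S` one vertex at a time, ending with m ≤ 2α - 1. This gives α + 1, which settles α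
≤ 6. For α ≥ 7 the bound α + 1/2 is proved, and it follows at once if m ≤ 2α - 2 is possible.

Otherwise any better start of the greedy process is a contradiction. Hence `G` has no induced claw
(`adj_of_claw`), and both ends of an induced path of odd order have private neighbours
(`IsInducedPath.exists_private`). A longest such path therefore closes up to an induced cycle of
length N ≤ 2α + 1, which is dominating. Deleting a suitable edge of the cycle leaves a path with B =
N/3 (`exists_cut_sum_abs_le`), and N/3 + 2 ≤ α + 1/2. -/

namespace SimpleGraph

/-! ### Subtrees, attachment of leaves, and the Wiener index over ordered pairs -/

variable {V : Type*}

/-- `T` is a subtree of `G` with vertex set `D` (together with isolated vertices outside `D`). -/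
structure IsTreeOn (G T : SimpleGraph V) (D : Finset V) : Prop where
  le : T ≤ G
  isAcyclic : T.IsAcyclic
  mem_of_adj : ∀ ⦃u v⦄, T.Adj u v → u ∈ D
  reachable : ∀ ⦃u⦄, u ∈ D → ∀ ⦃v⦄, v ∈ D → T.Reachable u v

lemma isTreeOn_bot_singleton (G : SimpleGraph V) (v : V) : G.IsTreeOn ⊥ {v} where
  le := bot_le
  isAcyclic := isAcyclic_bot
  mem_of_adj := by simp
  reachable := by
    intro u hu w hw
    rw [Finset.mem_singleton] at hu hw
    rw [hu, hw]

lemma IsTreeOn.isTree [Fintype V] [Nonempty V] {G T : SimpleGraph V}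
    (h : G.IsTreeOn T Finset.univ) : T.IsTree where
  preconnected u v := h.reachable (Finset.mem_univ u) (Finset.mem_univ v)
  nonempty := inferInstance
  isAcyclic := h.isAcyclic

variable [DecidableEq V]

/-- Attaching a leaf `x` to a vertex `c` of a subtree. -/
lemma IsTreeOn.exists_insert {G T : SimpleGraph V} {D : Finset V} (h : G.IsTreeOn T D) {c x : V}
    (hc : c ∈ D) (hx : x ∉ D) (hcx : G.Adj c x) :
    ∃ T', G.IsTreeOn T' (insert x D) ∧ (∀ u ∈ D, ∀ v ∈ D, T'.dist u v ≤ T.dist u v) ∧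
      ∀ v ∈ D, T'.dist x v ≤ T.dist c v + 1 := by
  have hne : c ≠ x := hcx.ne
  have hnr : ¬ T.Reachable x c := by
    rintro ⟨p⟩
    cases p with
    | nil => exact hx hc
    | cons hadj _ => exact hx (h.mem_of_adj hadj)
  have hle : T ≤ T ⊔ edge x c := le_sup_left
  have hadj : (T ⊔ edge x c).Adj x c := by
    rw [sup_adj, edge_adj]
    exact Or.inr ⟨Or.inl ⟨rfl, rfl⟩, hne.symm⟩
  have hreach : ∀ u ∈ D, (T ⊔ edge x c).Reachable x u := fun u hu =>
    hadj.reachable.trans ((h.reachable hc hu).mono hle)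
  refine ⟨T ⊔ edge x c, ⟨?_, h.isAcyclic.sup_edge_of_not_reachable hnr, ?_, ?_⟩, ?_, ?_⟩
  · refine sup_le h.le ?_
    intro u v huv
    rw [edge_adj] at huv
    rcases huv with ⟨⟨rfl, rfl⟩ | ⟨rfl, rfl⟩, _⟩
    · exact hcx.symm
    · exact hcx
  · intro u v huv
    rw [sup_adj, edge_adj] at huv
    rcases huv with huv | ⟨⟨rfl, rfl⟩ | ⟨rfl, rfl⟩, _⟩
    · exact Finset.mem_insert_of_mem (h.mem_of_adj huv)
    · exact Finset.mem_insert_self _ _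
    · exact Finset.mem_insert_of_mem hc
  · intro u hu v hv
    rw [Finset.mem_insert] at hu hv
    rcases hu with rfl | hu <;> rcases hv with rfl | hv
    · rfl
    · exact hreach v hv
    · exact (hreach u hu).symm
    · exact (h.reachable hu hv).mono hle
  · intro u hu v hv
    -- Reachability in `T` is needed: `dist` is 0 on unreachable pairs, so more edges could
    -- otherwise increase it.
    exact (h.reachable hu hv).dist_anti hle
  · intro v hv
    obtain ⟨p, hp⟩ := (h.reachable hc hv).exists_walk_length_eq_dist
    rw [← hp]
    refine (dist_le (Walk.cons hadj (p.mapLe hle))).trans ?_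
    simp

/-- Attaching all vertices outside a subtree as leaves to given neighbours in the subtree. -/
lemma IsTreeOn.exists_spanning [Fintype V] {G T : SimpleGraph V} {D : Finset V}
    (h : G.IsTreeOn T D) (f : V → V) (hf : ∀ v, f v ∈ D) (hfD : ∀ v ∈ D, f v = v)
    (hfadj : ∀ v ∉ D, G.Adj (f v) v) :
    ∃ T', G.IsTreeOn T' Finset.univ ∧ ∀ u v, u ≠ v → T'.dist u v ≤
      T.dist (f u) (f v) + (if u ∈ D then 0 else 1) + (if v ∈ D then 0 else 1) := by
  have key : ∀ F : Finset V, Disjoint F D → ∃ T', G.IsTreeOn T' (F ∪ D) ∧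
      ∀ u ∈ F ∪ D, ∀ v ∈ F ∪ D, u ≠ v → T'.dist u v ≤
        T.dist (f u) (f v) + (if u ∈ D then 0 else 1) + (if v ∈ D then 0 else 1) := by
    intro F
    induction F using Finset.induction_on with
    | empty =>
      intro _
      refine ⟨T, by simpa using h, ?_⟩
      intro u hu v hv _
      rw [Finset.empty_union] at hu hv
      simp [hu, hv, hfD]
    | insert x F hxF ih =>
      intro hdisj
      rw [Finset.disjoint_insert_left] at hdisj
      obtain ⟨T₁, hT₁, hd₁⟩ := ih hdisj.2
      have hx : x ∉ F ∪ D := by simp [hxF, hdisj.1]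
      obtain ⟨T₂, hT₂, hd₂, hd₂'⟩ := hT₁.exists_insert (Finset.mem_union_right F (hf x)) hx
        (hfadj x hdisj.1)
      have hxd : ∀ v ∈ F ∪ D, T₂.dist x v ≤ T.dist (f x) (f v) + 1 + (if v ∈ D then 0 else 1) := by
        intro v hv
        refine (hd₂' v hv).trans ?_
        by_cases hxv : f x = v
        · rw [hxv, dist_self]; omega
        · have := hd₁ (f x) (Finset.mem_union_right F (hf x)) v hv hxv
          rw [hfD _ (hf x), if_pos (hf x)] at this
          omega
      refine ⟨T₂, by rwa [Finset.insert_union], ?_⟩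
      intro u hu v hv huv
      rw [Finset.insert_union, Finset.mem_insert] at hu hv
      rcases hu with rfl | hu <;> rcases hv with rfl | hv
      · exact absurd rfl huv
      · rw [if_neg hdisj.1]
        exact hxd v hv
      · rw [if_neg hdisj.1, dist_comm, T.dist_comm (u := f u)]
        have := hxd u hu
        omega
      · exact (hd₂ u hu v hv).trans (hd₁ u hu v hv huv)
  obtain ⟨T', hT', hd⟩ := key Dᶜ disjoint_compl_left
  have : Dᶜ ∪ D = Finset.univ := by ext; simp; tauto
  rw [this] at hT' hd
  exact ⟨T', hT', fun u v => hd u (Finset.mem_univ u) v (Finset.mem_univ v)⟩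

/-- Twice the Wiener index is the sum of all distances over ordered pairs. -/
lemma two_mul_wienerIndex [Fintype V] (G : SimpleGraph V) :
    2 * G.wienerIndex = ∑ u, ∑ v, G.dist u v := by
  -- An arbitrary linear order turns each unordered pair into exactly one ordered pair with i < j.
  let _ : LinearOrder V := LinearOrder.lift' (Fintype.equivFin V) (Fintype.equivFin V).injective
  have h1 : G.wienerIndex = ∑ e ∈ (Finset.univ : Finset V).sym2 with ¬ e.IsDiag,
      Sym2.lift ⟨fun u v => G.dist u v, fun _ _ => dist_comm⟩ e := by
    unfold wienerIndex
    congr!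
  have h2 : G.wienerIndex = ∑ i : V × V with i.1 < i.2, G.dist i.1 i.2 := by
    rw [h1]
    convert Finset.sum_sym2_filter_not_isDiag (Finset.univ : Finset V)
      (Sym2.lift ⟨fun u v => G.dist u v, fun _ _ => dist_comm⟩) using 1
    · congr!
    · refine Finset.sum_congr ?_ fun i _ => rfl
      ext ⟨i, j⟩
      simp only [Finset.mem_filter, Finset.mem_univ, true_and, Finset.mem_offDiag]
      exact ⟨fun h => ⟨h.ne, h⟩, fun h => h.2⟩
  have h3 : G.wienerIndex = ∑ i : V × V with i.2 < i.1, G.dist i.1 i.2 := by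
    rw [h2]
    refine Finset.sum_nbij' Prod.swap Prod.swap ?_ ?_ ?_ ?_ ?_ <;> simp [dist_comm]
  rw [← Fintype.sum_prod_type', two_mul]
  nth_rewrite 1 [h2]
  rw [h3, Finset.sum_filter, Finset.sum_filter, ← Finset.sum_add_distrib]
  refine Finset.sum_congr rfl ?_
  rintro ⟨u, v⟩ _
  rcases lt_trichotomy u v with h | h | h
  · simp [h, h.not_gt]
  · simp [h]
  · simp [h, h.not_gt]

end SimpleGraph

/-! ### Spanning trees from connected dominating sets, and their greedy construction -/

namespace SimpleGraph

variable {V : Type*}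

lemma Connected.exists_adj_of_mem_of_notMem {G : SimpleGraph V} (hG : G.Connected) {s : Set V}
    {x y : V} (hx : x ∈ s) (hy : y ∉ s) : ∃ c ∈ s, ∃ u ∉ s, G.Adj c u := by
  obtain ⟨p⟩ := hG.preconnected x y
  obtain ⟨d, _, h1, h2⟩ := p.exists_boundary_dart s hx hy
  exact ⟨d.fst, h1, d.snd, h2, d.adj⟩

variable [DecidableEq V]

/-- A subtree `T` on a dominating set `D`, whose distances between the hubs `f v` are small on
average, extends to a spanning tree of small average distance. -/
lemma IsTreeOn.exists_isTree_averageDistance_lt [Fintype V] {G T : SimpleGraph V} {D : Finset V}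
    (h : G.IsTreeOn T D) (hV : 2 ≤ Fintype.card V) (f : V → V) (hf : ∀ v, f v ∈ D)
    (hfD : ∀ v ∈ D, f v = v) (hfadj : ∀ v ∉ D, G.Adj (f v) v) {B : ℝ} (hB : B < D.card)
    (hsum : ∑ u, ∑ v, (T.dist (f u) (f v) : ℝ) ≤ B * (Fintype.card V : ℝ) ^ 2) :
    ∃ T' ≤ G, T'.IsTree ∧ T'.averageDistance < B + 2 := by
  obtain ⟨T', hT', hd⟩ := h.exists_spanning f hf hfD hfadj
  have : Nonempty V := Fintype.card_pos_iff.1 (by omega)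
  refine ⟨T', hT'.le, hT'.isTree, ?_⟩
  set n : ℝ := (Fintype.card V : ℝ) with hn
  have hn2 : (2 : ℝ) ≤ n := by rw [hn]; exact_mod_cast hV
  let a : V → ℝ := fun u => if u ∈ D then 0 else 1
  have ha : ∑ u, a u = n - D.card := by
    have h1 : ∀ u, a u = 1 - (if u ∈ D then 1 else 0) := by
      intro u
      by_cases hu : u ∈ D <;> simp [a, hu]
    simp [h1, hn]
  have hW : (2 * T'.wienerIndex : ℝ) ≤ B * n ^ 2 + 2 * (n - D.card) * (n - 1) := by
    have h1 : (2 * T'.wienerIndex : ℝ) = ∑ u, ∑ v, (T'.dist u v : ℝ) := by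
      exact_mod_cast T'.two_mul_wienerIndex
    -- The correction on the diagonal turns the leaf contribution 2(n - |D|)n into 2(n - |D|)(n -
    -- 1).
    have h2 : ∀ u v, (T'.dist u v : ℝ) ≤
        T.dist (f u) (f v) + (a u + a v - if u = v then 2 * a u else 0) := by
      intro u v
      by_cases huv : u = v
      · subst huv
        rw [dist_self, dist_self, if_pos rfl]
        simp only [Nat.cast_zero]
        linarith
      · rw [if_neg huv]
        have h3 : (T'.dist u v : ℝ) ≤
            ((T.dist (f u) (f v) + (if u ∈ D then 0 else 1) + (if v ∈ D then 0 else 1) : ℕ) : ℝ) :=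
          by exact_mod_cast hd u v huv
        push_cast at h3
        simp only [a]
        linarith
    have h3 : ∑ u : V, ∑ v : V, (a u + a v - if u = v then 2 * a u else 0) =
        2 * (n - D.card) * (n - 1) := by
      simp only [Finset.sum_sub_distrib, Finset.sum_add_distrib, Finset.sum_const,
        Finset.card_univ, nsmul_eq_mul, Finset.sum_ite_eq, Finset.mem_univ, if_true,
        ← Finset.mul_sum, ha, ← hn]
      ring
    calc (2 * T'.wienerIndex : ℝ) = ∑ u, ∑ v, (T'.dist u v : ℝ) := h1
      _ ≤ ∑ u, ∑ v, (T.dist (f u) (f v) + (a u + a v - if u = v then 2 * a u else 0) : ℝ) :=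
        Finset.sum_le_sum fun u _ => Finset.sum_le_sum fun v _ => h2 u v
      _ = ∑ u, ∑ v, (T.dist (f u) (f v) : ℝ) + 2 * (n - D.card) * (n - 1) := by
        rw [← h3, ← Finset.sum_add_distrib]
        exact Finset.sum_congr rfl fun u _ => Finset.sum_add_distrib
      _ ≤ _ := by linarith
  have hch : ((Fintype.card V).choose 2 : ℝ) = n * (n - 1) / 2 := Nat.cast_choose_two ℝ _
  have hpos : 0 < n * (n - 1) / 2 := by
    have := mul_pos (by linarith : 0 < n) (by linarith : 0 < n - 1)
    linarith
  rw [averageDistance, hch, div_lt_iff₀ hpos]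
  have hD0 : (0 : ℝ) ≤ D.card := Nat.cast_nonneg _
  have h5 : B * n < 2 * D.card * (n - 1) := by
    have h6 : B * n < D.card * n := mul_lt_mul_of_pos_right hB (by linarith)
    have h7 : (0 : ℝ) ≤ D.card * (n - 2) := mul_nonneg hD0 (by linarith)
    linarith
  linarith

/-- Sets of vertices obtained from a single vertex by repeatedly adding a neighbour. -/
inductive IsGrown (G : SimpleGraph V) : Finset V → Prop
  | singleton (v : V) : IsGrown G {v}
  | adjoin {D : Finset V} {c x : V} : IsGrown G D → c ∈ D → x ∉ D → G.Adj c x →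
      IsGrown G (insert x D)

lemma IsGrown.nonempty {G : SimpleGraph V} {D : Finset V} (h : G.IsGrown D) : D.Nonempty := by
  cases h with
  | singleton v => exact Finset.singleton_nonempty v
  | adjoin _ _ _ _ => exact Finset.insert_nonempty _ _

/-- A connected set `D` carries a tree such that any distribution of `n` points on `D` has total
distance at most `(|D| - 1) n ^ 2 / 2`. -/
lemma IsGrown.exists_isTreeOn_sum_dist_le [Fintype V] {G : SimpleGraph V} {D : Finset V}
    (h : G.IsGrown D) :
    ∃ T, G.IsTreeOn T D ∧ ∀ f : V → V, (∀ v, f v ∈ D) →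
      ∑ u, ∑ v, (T.dist (f u) (f v) : ℝ) ≤
        ((D.card : ℝ) - 1) / 2 * (Fintype.card V : ℝ) ^ 2 := by
  induction h with
  | singleton v =>
    refine ⟨⊥, G.isTreeOn_bot_singleton v, fun f hf => ?_⟩
    simp
  | @adjoin D c x _ hc hx hcx ih =>
    obtain ⟨T, hT, hs⟩ := ih
    obtain ⟨T', hT', hd, hd'⟩ := hT.exists_insert hc hx hcx
    refine ⟨T', hT', fun f hf => ?_⟩
    -- Moving the points at the new leaf `x` to `c` shortens distances only for pairs separated by
    -- the edge `c x`; there are 2A(n - A) ≤ n²/2 of them, where A is the number of points at `x`.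
    let g : V → V := fun v => if f v = x then c else f v
    let a : V → ℝ := fun v => if f v = x then 1 else 0
    have hg : ∀ v, g v ∈ D := by
      intro v
      by_cases hv : f v = x
      · simpa [g, hv] using hc
      · simpa [g, hv] using hf v
    have h1 : ∀ u v, (T'.dist (f u) (f v) : ℝ) ≤
        T.dist (g u) (g v) + (a u * (1 - a v) + (1 - a u) * a v) := by
      intro u v
      by_cases hu : f u = x <;> by_cases hv : f v = x
      · simp [g, a, hu, hv]
      · have hfv : f v ∈ D := by simpa [hv] using hf v
        simp only [g, a, hu, hv, if_true, if_false]
        have : (T'.dist x (f v) : ℝ) ≤ ((T.dist c (f v) + 1 : ℕ) : ℝ) := by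
          exact_mod_cast hd' _ hfv
        push_cast at this
        linarith
      · have hfu : f u ∈ D := by simpa [hu] using hf u
        simp only [g, a, hu, hv, if_true, if_false]
        have : (T'.dist x (f u) : ℝ) ≤ ((T.dist c (f u) + 1 : ℕ) : ℝ) := by
          exact_mod_cast hd' _ hfu
        push_cast at this
        rw [T'.dist_comm, T.dist_comm]
        linarith
      · have hfu : f u ∈ D := by simpa [hu] using hf u
        have hfv : f v ∈ D := by simpa [hv] using hf v
        simp only [g, a, hu, hv, if_false]
        have : (T'.dist (f u) (f v) : ℝ) ≤ T.dist (f u) (f v) := by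
          exact_mod_cast hd _ hfu _ hfv
        linarith
    set n : ℝ := (Fintype.card V : ℝ) with hn
    have h2 : ∑ u : V, ∑ v : V, (a u * (1 - a v) + (1 - a u) * a v) ≤ n ^ 2 / 2 := by
      have : ∑ u : V, ∑ v : V, (a u * (1 - a v) + (1 - a u) * a v) =
          2 * ((∑ u, a u) * (n - ∑ u, a u)) := by
        simp only [Finset.sum_add_distrib, ← Finset.mul_sum, ← Finset.sum_mul,
          Finset.sum_sub_distrib, Finset.sum_const, Finset.card_univ, nsmul_eq_mul, mul_one, ← hn]
        ring
      rw [this]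
      nlinarith [sq_nonneg (n - 2 * ∑ u, a u)]
    calc ∑ u, ∑ v, (T'.dist (f u) (f v) : ℝ)
        ≤ ∑ u, ∑ v, (T.dist (g u) (g v) + (a u * (1 - a v) + (1 - a u) * a v) : ℝ) :=
          Finset.sum_le_sum fun u _ => Finset.sum_le_sum fun v _ => h1 u v
      _ = ∑ u, ∑ v, (T.dist (g u) (g v) : ℝ) +
            ∑ u : V, ∑ v : V, (a u * (1 - a v) + (1 - a u) * a v) := by
          rw [← Finset.sum_add_distrib]
          exact Finset.sum_congr rfl fun u _ => Finset.sum_add_distrib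
      _ ≤ ((D.card : ℝ) - 1) / 2 * n ^ 2 + n ^ 2 / 2 := add_le_add (hs g hg) h2
      _ = _ := by
          rw [Finset.card_insert_of_notMem hx]
          push_cast
          ring

/-- Every vertex outside `D` has a neighbour in `D`. -/
def IsDominating (G : SimpleGraph V) (D : Finset V) : Prop :=
  ∀ v ∉ D, ∃ c ∈ D, G.Adj c v

lemma IsDominating.exists_hub {G : SimpleGraph V} {D : Finset V} (hD : G.IsDominating D) :
    ∃ f : V → V, (∀ v, f v ∈ D) ∧ (∀ v ∈ D, f v = v) ∧ ∀ v ∉ D, G.Adj (f v) v := by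
  have : ∀ v, ∃ c ∈ D, (v ∈ D → c = v) ∧ (v ∉ D → G.Adj c v) := by
    intro v
    by_cases hv : v ∈ D
    · exact ⟨v, hv, fun _ => rfl, fun h => absurd hv h⟩
    · obtain ⟨c, hc, hcv⟩ := hD v hv
      exact ⟨c, hc, fun h => absurd h hv, fun _ => hcv⟩
  choose f hf hfD hfadj using this
  exact ⟨f, hf, hfD, hfadj⟩

/-- A connected dominating set of order `m` yields a spanning tree of average distance less
than `(m + 3) / 2`. -/
lemma IsGrown.exists_isTree_averageDistance_lt [Fintype V] {G : SimpleGraph V} {D : Finset V}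
    (h : G.IsGrown D) (hdom : G.IsDominating D) (hV : 2 ≤ Fintype.card V) :
    ∃ T ≤ G, T.IsTree ∧ T.averageDistance < ((D.card : ℝ) + 3) / 2 := by
  obtain ⟨T, hT, hs⟩ := h.exists_isTreeOn_sum_dist_le
  obtain ⟨f, hf, hfD, hfadj⟩ := hdom.exists_hub
  have hpos : (0 : ℝ) < D.card := by exact_mod_cast h.nonempty.card_pos
  obtain ⟨T', hle, htree, hlt⟩ := hT.exists_isTree_averageDistance_lt hV f hf hfD hfadj
    (B := ((D.card : ℝ) - 1) / 2) (by linarith) (hs f hf)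
  exact ⟨T', hle, htree, by linarith⟩

/-- A walk from `D` to an undominated vertex leaves the closed neighbourhood of `D` along some edge
`c u`; here `c` is not in `D`, since otherwise `u` would be dominated. -/
lemma IsGrown.exists_adj_adj {G : SimpleGraph V} {D : Finset V} (h : G.IsGrown D)
    (hG : G.Connected) (hD : ¬ G.IsDominating D) :
    ∃ d ∈ D, ∃ c ∉ D, ∃ u ∉ D, G.Adj d c ∧ G.Adj c u ∧ ∀ x ∈ D, ¬ G.Adj x u := by
  rw [IsDominating] at hD
  push Not at hD
  obtain ⟨w, hw, hw'⟩ := hD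
  obtain ⟨x, hx⟩ := h.nonempty
  obtain ⟨c, hc, u, hu, hcu⟩ := hG.exists_adj_of_mem_of_notMem
    (s := {v | v ∈ D ∨ ∃ d ∈ D, G.Adj d v}) (x := x) (y := w) (Or.inl hx) (by
      rintro (h1 | ⟨d, hd, hdw⟩)
      · exact hw h1
      · exact hw' d hd hdw)
  simp only [Set.mem_ofPred_eq, not_or, not_exists, not_and] at hc hu
  have hcD : c ∉ D := fun h1 => hu.2 c h1 hcu
  obtain hc | ⟨d, hd, hdc⟩ := hc
  · exact absurd hc hcD
  · exact ⟨d, hd, c, hcD, u, hu.1, hdc, hcu, hu.2⟩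

/-- A connected set `D` whose closed neighbourhood contains that of an independent set `S` with
`|D| + s ≤ 2 |S|` extends to a connected dominating set of order at most `2 α - s`. -/
lemma IsGrown.exists_isDominating [Fintype V] {G : SimpleGraph V} (hG : G.Connected) {s : ℕ}
    {D S : Finset V} (hD : G.IsGrown D) (hS : G.IsIndepSet (S : Set V))
    (hSD : D.card + s ≤ 2 * S.card)
    (hmem : ∀ v ∈ S, v ∈ D ∨ ∃ d ∈ D, G.Adj d v)
    (hN : ∀ v ∈ S, ∀ w, G.Adj v w → w ∈ D ∨ ∃ d ∈ D, G.Adj d w) :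
    ∃ D', G.IsGrown D' ∧ G.IsDominating D' ∧ D'.card + s ≤ 2 * G.indepNum := by
  induction hk : Fintype.card V - D.card using Nat.strong_induction_on generalizing D S with
  | _ k ih =>
    by_cases hdom : G.IsDominating D
    · exact ⟨D, hD, hdom, hSD.trans (Nat.mul_le_mul_left 2 hS.card_le_indepNum)⟩
    · obtain ⟨d, hd, c, hc, u, hu, hdc, hcu, hDu⟩ := hD.exists_adj_adj hG hdom
      have hu' : u ∉ insert c D := by
        rw [Finset.mem_insert, not_or]
        exact ⟨hcu.ne', hu⟩
      -- `u` is at distance two from `D`, while `D` dominates `S` and all its neighbours. So `u` can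
      -- join `S`, and adding `c`, `u` to `D` raises both sides of `hSD` by 2.
      have hSu : ∀ v ∈ S, ¬ G.Adj v u := by
        intro v hv hvu
        rcases hN v hv u hvu with h1 | ⟨x, hx, hxu⟩
        · exact hu h1
        · exact hDu x hx hxu
      have huS : u ∉ S := by
        intro h1
        rcases hmem u h1 with h2 | ⟨x, hx, hxu⟩
        · exact hu h2
        · exact hDu x hx hxu
      have hD' : G.IsGrown (insert u (insert c D)) :=
        (hD.adjoin hd hc hdc).adjoin (Finset.mem_insert_self c D) hu' hcu
      have hcard : (insert u (insert c D)).card = D.card + 2 := by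
        rw [Finset.card_insert_of_notMem hu', Finset.card_insert_of_notMem hc]
      have hle : (insert u (insert c D)).card ≤ Fintype.card V := Finset.card_le_univ _
      refine ih (Fintype.card V - (insert u (insert c D)).card) (by omega)
        (S := insert u S) hD' ?_ ?_ ?_ ?_ rfl
      · rw [Finset.coe_insert]
        intro x hx y hy hxy
        rcases hx with rfl | hx <;> rcases hy with rfl | hy
        · exact absurd rfl hxy
        · exact fun h1 => hSu y hy h1.symm
        · exact hSu x hx
        · exact hS hx hy hxy
      · rw [hcard, Finset.card_insert_of_notMem huS]
        omega
      · intro v hv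
        rw [Finset.mem_insert] at hv
        rcases hv with rfl | hv
        · exact Or.inl (Finset.mem_insert_self _ _)
        · rcases hmem v hv with h1 | ⟨x, hx, hxv⟩
          · exact Or.inl (by simp [h1])
          · exact Or.inr ⟨x, by simp [hx], hxv⟩
      · intro v hv w hvw
        rw [Finset.mem_insert] at hv
        rcases hv with rfl | hv
        · exact Or.inr ⟨v, Finset.mem_insert_self _ _, hvw⟩
        · rcases hN v hv w hvw with h1 | ⟨x, hx, hxv⟩
          · exact Or.inl (by simp [h1])
          · exact Or.inr ⟨x, by simp [hx], hxv⟩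

end SimpleGraph

/-! ### Cutting a cycle into a path -/

lemma ZMod.sum_val_lt (N : ℕ) [NeZero N] {g : ℕ} (hg : g ≤ N) (x : ZMod N) :
    ∑ j : ZMod N, (if (x - j).val < g then (1 : ℝ) else 0) = g := by
  have h := Equiv.sum_comp (Equiv.subLeft x) (fun i : ZMod N => if i.val < g then (1 : ℝ) else 0)
  simp only [Equiv.subLeft_apply] at h
  rw [h, ← Finset.sum_filter, Finset.sum_const, nsmul_eq_mul, mul_one]
  congr 1
  rw [← Finset.card_range g]
  refine Finset.card_nbij' ZMod.val (fun i => (i : ZMod N)) ?_ ?_ ?_ ?_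
  · intro i hi
    simpa using hi
  · intro i hi
    have hi' : i < g := by simpa using hi
    simpa [ZMod.val_natCast_of_lt (hi'.trans_le hg)] using hi'
  · intro i _
    simp
  · intro i hi
    have hi' : i < g := by simpa using hi
    exact ZMod.val_natCast_of_lt (hi'.trans_le hg)

lemma sum_range_separated {N a b : ℕ} (hb : b < N) (hab : a ≤ b) :
    ∑ g ∈ Finset.range N, ((if a < g then (1 : ℝ) else 0) * (1 - if b < g then (1 : ℝ) else 0) +
      (1 - if a < g then (1 : ℝ) else 0) * if b < g then (1 : ℝ) else 0) = b - a := by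
  have h1 : ∀ g, ((if a < g then (1 : ℝ) else 0) * (1 - if b < g then (1 : ℝ) else 0) +
      (1 - if a < g then (1 : ℝ) else 0) * if b < g then (1 : ℝ) else 0) =
      if g ∈ Finset.Ioc a b then 1 else 0 := by
    intro g
    simp only [Finset.mem_Ioc]
    split_ifs <;> first | omega | norm_num
  simp only [h1]
  rw [← Finset.sum_filter, Finset.sum_const, nsmul_eq_mul, mul_one]
  have h2 : (Finset.range N).filter (fun g => g ∈ Finset.Ioc a b) = Finset.Ioc a b := by
    ext g
    simp only [Finset.mem_filter, Finset.mem_range, Finset.mem_Ioc]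
    omega
  rw [h2, Nat.card_Ioc, Nat.cast_sub hab]

/-- The distance of two positions on a path is the number of edges separating them; each summand
indicates whether exactly one of the two lies before gap `g`. -/
lemma abs_sub_eq_sum_range_separated {N a b : ℕ} (ha : a < N) (hb : b < N) :
    |(a : ℝ) - b| = ∑ g ∈ Finset.range N,
      ((if a < g then (1 : ℝ) else 0) * (1 - if b < g then (1 : ℝ) else 0) +
        (1 - if a < g then (1 : ℝ) else 0) * if b < g then (1 : ℝ) else 0) := by
  rcases le_total a b with h | h
  · rw [sum_range_separated hb h, abs_sub_comm, abs_of_nonneg]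
    exact sub_nonneg.2 (Nat.cast_le.2 h)
  · rw [abs_of_nonneg (sub_nonneg.2 (Nat.cast_le.2 h)), ← sum_range_separated ha h]
    exact Finset.sum_congr rfl fun g _ => by ring

/-- Points on a cycle of length `N`: some edge of the cycle can be deleted so that the total
distance along the remaining path is at most `N n ^ 2 / 3`. -/
lemma exists_cut_sum_abs_le {V : Type*} [Fintype V] (N : ℕ) [NeZero N] (H : V → ZMod N) :
    ∃ j : ZMod N, ∑ u, ∑ v, |((H u - j).val : ℝ) - (H v - j).val| ≤
      (N : ℝ) / 3 * (Fintype.card V : ℝ) ^ 2 := by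
  set n : ℝ := (Fintype.card V : ℝ) with hn
  have hN : (0 : ℝ) < N := by exact_mod_cast NeZero.pos N
  let χ : ℕ → ZMod N → V → ℝ := fun g j u => if (H u - j).val < g then 1 else 0
  have h1 : ∀ j, ∑ u, ∑ v, |((H u - j).val : ℝ) - (H v - j).val| =
      ∑ g ∈ Finset.range N, 2 * ((∑ u, χ g j u) * (n - ∑ u, χ g j u)) := by
    intro j
    have : ∀ u v, |((H u - j).val : ℝ) - (H v - j).val| = ∑ g ∈ Finset.range N,
        (χ g j u * (1 - χ g j v) + (1 - χ g j u) * χ g j v) := fun u v =>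
      abs_sub_eq_sum_range_separated (ZMod.val_lt _) (ZMod.val_lt _)
    simp only [this]
    rw [Finset.sum_congr rfl fun u _ => Finset.sum_comm, Finset.sum_comm]
    refine Finset.sum_congr rfl fun g _ => ?_
    simp only [Finset.sum_add_distrib, ← Finset.mul_sum, ← Finset.sum_mul,
      Finset.sum_sub_distrib, Finset.sum_const, Finset.card_univ, nsmul_eq_mul, mul_one, ← hn]
    ring
  have h2 : ∀ g ∈ Finset.range N, ∑ j, ∑ u, χ g j u = n * g := by
    intro g hg
    rw [Finset.sum_comm]
    simp only [χ, ZMod.sum_val_lt N (Finset.mem_range.1 hg).le, Finset.sum_const,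
      Finset.card_univ, nsmul_eq_mul, ← hn]
  have h3 : ∀ g ∈ Finset.range N, ∑ j, 2 * ((∑ u, χ g j u) * (n - ∑ u, χ g j u)) ≤
      2 * n ^ 2 * (g - (g : ℝ) ^ 2 / N) := by
    intro g hg
    -- The concave function 2A(n - A) lies below its tangent at A = n g / N, which by `h2` is the
    -- mean of A over all cuts `j`.
    have h4 : ∀ j, 2 * ((∑ u, χ g j u) * (n - ∑ u, χ g j u)) ≤
        2 * (n - 2 * (n * g / N)) * (∑ u, χ g j u) + 2 * (n * g / N) ^ 2 := by
      intro j
      nlinarith [sq_nonneg ((∑ u, χ g j u) - n * g / N)]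
    refine (Finset.sum_le_sum fun j _ => h4 j).trans (le_of_eq ?_)
    rw [Finset.sum_add_distrib, ← Finset.mul_sum, h2 g hg, Finset.sum_const, Finset.card_univ,
      ZMod.card, nsmul_eq_mul]
    field_simp
    ring
  have h5 : ∀ m : ℕ, ∑ g ∈ Finset.range m, ((g : ℝ) - (g : ℝ) ^ 2 / N) =
      (m : ℝ) * (m - 1) / 2 - (m : ℝ) * (m - 1) * (2 * m - 1) / (6 * N) := by
    intro m
    induction m with
    | zero => simp
    | succ m ih =>
      rw [Finset.sum_range_succ, ih]
      push_cast
      field_simp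
      ring
  have h6 : ∑ j : ZMod N, ∑ u, ∑ v, |((H u - j).val : ℝ) - (H v - j).val| ≤
      ∑ _j : ZMod N, (N : ℝ) / 3 * n ^ 2 := by
    simp only [h1]
    rw [Finset.sum_comm]
    refine (Finset.sum_le_sum h3).trans ?_
    rw [← Finset.mul_sum, h5, Finset.sum_const, Finset.card_univ, ZMod.card, nsmul_eq_mul]
    have h7 : 2 * n ^ 2 * ((N : ℝ) * (N - 1) / 2 - (N : ℝ) * (N - 1) * (2 * N - 1) / (6 * N)) =
        (N : ℝ) * (N / 3 * n ^ 2) - n ^ 2 / 3 := by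
      field_simp
      ring
    rw [h7]
    linarith [sq_nonneg n]
  obtain ⟨j, _, hj⟩ := Finset.exists_le_of_sum_le Finset.univ_nonempty h6
  exact ⟨j, hj⟩

namespace SimpleGraph

variable {V : Type*} [DecidableEq V]

/-- With truncated subtraction, (i - j) + (j - i) is the distance |i - j|. -/
lemma exists_isTreeOn_path {G : SimpleGraph V} (p : ℕ → V) {m : ℕ}
    (hinj : ∀ i ≤ m, ∀ j ≤ m, p i = p j → i = j) (hadj : ∀ i < m, G.Adj (p i) (p (i + 1))) :
    ∃ T, G.IsTreeOn T ((Finset.range (m + 1)).image p) ∧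
      ∀ i ≤ m, ∀ j ≤ m, T.dist (p i) (p j) ≤ (i - j) + (j - i) := by
  induction m with
  | zero =>
    refine ⟨⊥, by simpa using G.isTreeOn_bot_singleton (p 0), ?_⟩
    intro i hi j hj
    obtain rfl : i = 0 := by omega
    obtain rfl : j = 0 := by omega
    simp
  | succ m ih =>
    obtain ⟨T, hT, hd⟩ := ih (fun i hi j hj => hinj i (by omega) j (by omega))
      (fun i hi => hadj i (by omega))
    have hmem : ∀ i ≤ m, p i ∈ (Finset.range (m + 1)).image p := fun i hi =>
      Finset.mem_image_of_mem p (Finset.mem_range.2 (by omega))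
    have hnot : p (m + 1) ∉ (Finset.range (m + 1)).image p := by
      intro h
      obtain ⟨i, hi, hpi⟩ := Finset.mem_image.1 h
      rw [Finset.mem_range] at hi
      have := hinj i (by omega) (m + 1) le_rfl hpi
      omega
    obtain ⟨T', hT', hd₁, hd₂⟩ := hT.exists_insert (hmem m le_rfl) hnot (hadj m (by omega))
    refine ⟨T', by rwa [Finset.range_add_one, Finset.image_insert], ?_⟩
    intro i hi j hj
    rcases Nat.lt_or_ge m i with hi' | hi' <;> rcases Nat.lt_or_ge m j with hj' | hj'
    · obtain rfl : i = m + 1 := by omega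
      obtain rfl : j = m + 1 := by omega
      simp
    · obtain rfl : i = m + 1 := by omega
      have h1 := hd₂ (p j) (hmem j hj')
      have h2 := hd m le_rfl j hj'
      omega
    · obtain rfl : j = m + 1 := by omega
      have h1 := hd₂ (p i) (hmem i hi')
      have h2 := hd m le_rfl i hi'
      rw [dist_comm]
      omega
    · exact (hd₁ _ (hmem i hi') _ (hmem j hj')).trans (hd i hi' j hj')

/-- A dominating cycle of length `N` yields a spanning tree of average distance less than
`N / 3 + 2`. -/
lemma exists_isTree_averageDistance_lt_of_cycle [Fintype V] {G : SimpleGraph V} (N : ℕ) [NeZero N]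
    (z : ZMod N → V) (hz : Function.Injective z) (hadj : ∀ i, G.Adj (z i) (z (i + 1)))
    (hdom : G.IsDominating (Finset.univ.image z)) (hV : 2 ≤ Fintype.card V) :
    ∃ T ≤ G, T.IsTree ∧ T.averageDistance < (N : ℝ) / 3 + 2 := by
  obtain ⟨f, hf, hfD, hfadj⟩ := hdom.exists_hub
  have : ∀ v, ∃ i, z i = f v := fun v => by
    obtain ⟨i, _, hi⟩ := Finset.mem_image.1 (hf v)
    exact ⟨i, hi⟩
  choose H hH using this
  obtain ⟨j, hj⟩ := exists_cut_sum_abs_le N H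
  have hN : N - 1 + 1 = N := Nat.sub_add_cancel (NeZero.pos N)
  -- Deleting the edge from `z (j - 1)` to `z j` leaves this path, on which `z i` has position `(i -
  -- j).val`.
  let p : ℕ → V := fun i => z (j + i)
  obtain ⟨T, hT, hd⟩ := exists_isTreeOn_path (G := G) p (m := N - 1) (by
      intro i hi i' hi' h
      have h1 := congrArg ZMod.val (add_left_cancel (hz h))
      rwa [ZMod.val_natCast_of_lt (by omega), ZMod.val_natCast_of_lt (by omega)] at h1) (by
      intro i _
      have := hadj (j + i)
      simpa [p, add_assoc] using this)
  have hp : ∀ i : ZMod N, p (i - j).val = z i := by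
    intro i
    simp [p]
  have himage : (Finset.range (N - 1 + 1)).image p = Finset.univ.image z := by
    ext v
    simp only [Finset.mem_image, Finset.mem_range, Finset.mem_univ, true_and]
    constructor
    · rintro ⟨i, _, rfl⟩
      exact ⟨_, rfl⟩
    · rintro ⟨i, rfl⟩
      exact ⟨(i - j).val, by rw [hN]; exact ZMod.val_lt _, hp i⟩
  rw [himage] at hT
  have hcard : (Finset.univ.image z).card = N := by
    rw [Finset.card_image_of_injective _ hz, Finset.card_univ, ZMod.card]
  refine hT.exists_isTree_averageDistance_lt hV f hf hfD hfadj (B := (N : ℝ) / 3) ?_ ?_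
  · rw [hcard]
    have : (0 : ℝ) < N := by exact_mod_cast NeZero.pos N
    linarith
  · refine le_trans (Finset.sum_le_sum fun u _ => Finset.sum_le_sum fun v _ => ?_) hj
    have hlt : ∀ i : ZMod N, i.val ≤ N - 1 := fun i => Nat.le_sub_one_of_lt (ZMod.val_lt i)
    have h1 := hd _ (hlt (H u - j)) _ (hlt (H v - j))
    rw [hp, hp, hH, hH] at h1
    have h2 : (T.dist (f u) (f v) : ℝ) ≤
        (((H u - j).val - (H v - j).val + ((H v - j).val - (H u - j).val) : ℕ) : ℝ) := by
      exact_mod_cast h1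
    refine h2.trans ?_
    rcases le_total (H u - j).val (H v - j).val with h | h
    · rw [Nat.sub_eq_zero_of_le h, zero_add, Nat.cast_sub h, abs_sub_comm]
      exact le_abs_self _
    · rw [Nat.sub_eq_zero_of_le h, add_zero, Nat.cast_sub h]
      exact le_abs_self _

end SimpleGraph

/-! ### Induced paths and induced cycles -/

lemma ZMod.natCast_inj_of_lt {N i j : ℕ} (hi : i < N) (hj : j < N) :
    (i : ZMod N) = j ↔ i = j := by
  rw [ZMod.natCast_eq_natCast_iff', Nat.mod_eq_of_lt hi, Nat.mod_eq_of_lt hj]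

namespace SimpleGraph

variable {V : Type*}

/-- The first `m` terms of `p` are the vertices of an induced path. -/
structure IsInducedPath (G : SimpleGraph V) (p : ℕ → V) (m : ℕ) : Prop where
  inj : ∀ ⦃i⦄, i < m → ∀ ⦃j⦄, j < m → p i = p j → i = j
  adj_iff : ∀ ⦃i⦄, i < m → ∀ ⦃j⦄, j < m → (G.Adj (p i) (p j) ↔ i + 1 = j ∨ j + 1 = i)

lemma IsInducedPath.reverse {G : SimpleGraph V} {p : ℕ → V} {m : ℕ} (h : G.IsInducedPath p (m + 1)) :
    G.IsInducedPath (fun i => p (m - i)) (m + 1) where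
  inj i hi j hj hij := by
    have := h.inj (by omega) (by omega) hij
    omega
  adj_iff i hi j hj := by
    rw [h.adj_iff (by omega) (by omega)]
    omega

lemma IsInducedPath.shift {G : SimpleGraph V} {p : ℕ → V} {m : ℕ} (h : G.IsInducedPath p (m + 1)) :
    G.IsInducedPath (fun i => p (i + 1)) m where
  inj i hi j hj hij := by
    have := h.inj (by omega) (by omega) hij
    omega
  adj_iff i hi j hj := by
    rw [h.adj_iff (by omega) (by omega)]
    omega

variable [DecidableEq V]

lemma isGrown_image_range {G : SimpleGraph V} (p : ℕ → V) {m : ℕ}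
    (hinj : ∀ i ≤ m, ∀ j ≤ m, p i = p j → i = j) (hadj : ∀ i < m, G.Adj (p i) (p (i + 1))) :
    G.IsGrown ((Finset.range (m + 1)).image p) := by
  induction m with
  | zero => simpa using IsGrown.singleton (p 0)
  | succ m ih =>
    rw [Finset.range_add_one, Finset.image_insert]
    refine (ih (fun i hi j hj => hinj i (by omega) j (by omega))
      (fun i hi => hadj i (by omega))).adjoin
      (Finset.mem_image_of_mem p (Finset.self_mem_range_succ m)) ?_ (hadj m (by omega))
    intro h
    obtain ⟨i, hi, hpi⟩ := Finset.mem_image.1 h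
    rw [Finset.mem_range] at hi
    have := hinj i (by omega) (m + 1) le_rfl hpi
    omega

lemma IsInducedPath.isGrown {G : SimpleGraph V} {p : ℕ → V} {m : ℕ}
    (h : G.IsInducedPath p (m + 1)) : G.IsGrown ((Finset.range (m + 1)).image p) :=
  isGrown_image_range p (fun i hi j hj => h.inj (by omega) (by omega))
    fun i hi => (h.adj_iff (by omega) (by omega)).2 (Or.inl rfl)

lemma IsInducedPath.card {G : SimpleGraph V} {p : ℕ → V} {m : ℕ}
    (h : G.IsInducedPath p m) : ((Finset.range m).image p).card = m := by
  rw [Finset.card_image_of_injOn, Finset.card_range]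
  intro i hi j hj hij
  exact h.inj (by simpa using hi) (by simpa using hj) hij

lemma IsInducedPath.isIndepSet_even {G : SimpleGraph V} {p : ℕ → V} {k : ℕ}
    (h : G.IsInducedPath p (2 * k + 1)) :
    G.IsIndepSet (((Finset.range (k + 1)).image fun i => p (2 * i) : Finset V) : Set V) ∧
      ((Finset.range (k + 1)).image fun i => p (2 * i)).card = k + 1 := by
  constructor
  · intro x hx y hy _
    simp only [Finset.coe_image, Set.mem_image, Finset.mem_coe, Finset.mem_range] at hx hy
    obtain ⟨i, hi, rfl⟩ := hx
    obtain ⟨j, hj, rfl⟩ := hy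
    rw [h.adj_iff (by omega) (by omega)]
    omega
  · rw [Finset.card_image_of_injOn, Finset.card_range]
    intro i hi j hj hij
    simp only [Finset.coe_range, Set.mem_Iio] at hi hj
    have := h.inj (by omega) (by omega) hij
    omega

/-- The vertices `z i` form an induced cycle. -/
structure IsInducedCycle (G : SimpleGraph V) {N : ℕ} (z : ZMod N → V) : Prop where
  inj : Function.Injective z
  adj_iff : ∀ i j, G.Adj (z i) (z j) ↔ j = i + 1 ∨ i = j + 1

lemma IsInducedCycle.isGrown {G : SimpleGraph V} {N : ℕ} [NeZero N] {z : ZMod N → V}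
    (h : G.IsInducedCycle z) : G.IsGrown (Finset.univ.image z) := by
  have hN : N - 1 + 1 = N := Nat.sub_add_cancel (NeZero.pos N)
  have h1 := isGrown_image_range (G := G) (fun i : ℕ => z i) (m := N - 1) (by
      intro i hi j hj hij
      have h1 := congrArg ZMod.val (h.inj hij)
      rwa [ZMod.val_natCast_of_lt (by omega), ZMod.val_natCast_of_lt (by omega)] at h1) (by
      intro i _
      rw [h.adj_iff]
      left
      push_cast
      rfl)
  convert h1
  ext v
  simp only [Finset.mem_image, Finset.mem_range, Finset.mem_univ, true_and]
  constructor
  · rintro ⟨i, rfl⟩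
    exact ⟨i.val, by rw [hN]; exact ZMod.val_lt _, by simp⟩
  · rintro ⟨i, _, rfl⟩
    exact ⟨_, rfl⟩

/-! ### The extremal case: no connected dominating set of order at most 2α - 2 -/

variable [Fintype V]

/-- If all connected dominating sets have order at least `2 α - 1`, there is no induced claw. -/
lemma adj_of_claw {G : SimpleGraph V} (hG : G.Connected)
    (hno : ∀ D, G.IsGrown D → G.IsDominating D → 2 * G.indepNum < D.card + 2)
    {x a b c : V} (hxa : G.Adj x a) (hxb : G.Adj x b) (hxc : G.Adj x c)
    (hab : a ≠ b) (hac : a ≠ c) (hbc : b ≠ c) : G.Adj a b ∨ G.Adj a c ∨ G.Adj b c := by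
  by_contra! hcon
  obtain ⟨h1, h2, h3⟩ := hcon
  have hD : G.IsGrown (insert c (insert b (insert a {x}))) := by
    refine (((IsGrown.singleton x).adjoin (c := x) ?_ ?_ hxa).adjoin (c := x) ?_ ?_ hxb).adjoin
      (c := x) ?_ ?_ hxc
    · simp
    · simpa using hxa.ne'
    · simp
    · simpa using ⟨hab.symm, hxb.ne'⟩
    · simp
    · simpa using ⟨hbc.symm, hac.symm, hxc.ne'⟩
  have hS : G.IsIndepSet (({a, b, c} : Finset V) : Set V) := by
    intro u hu v hv huv
    simp only [Finset.coe_insert, Finset.coe_singleton, Set.mem_insert_iff,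
      Set.mem_singleton_iff] at hu hv
    rcases hu with rfl | rfl | rfl <;> rcases hv with rfl | rfl | rfl <;>
      first
      | exact absurd rfl huv
      | assumption
      | (rw [G.adj_comm]; assumption)
  have hScard : ({a, b, c} : Finset V).card = 3 := Finset.card_eq_three.2 ⟨a, b, c, hab, hac, hbc, rfl⟩
  have hDcard : (insert c (insert b (insert a ({x} : Finset V)))).card ≤ 4 := Finset.card_le_four
  -- The claw has order 4 and its three leaves are independent: 4 + 2 = 2 · 3.
  obtain ⟨D', h4, h5, h6⟩ := hD.exists_isDominating hG (s := 2) hS (by omega)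
    (by
      intro v hv
      simp only [Finset.mem_insert, Finset.mem_singleton] at hv
      refine Or.inl ?_
      simp only [Finset.mem_insert, Finset.mem_singleton]
      tauto)
    (by
      intro v hv w hvw
      refine Or.inr ⟨v, ?_, hvw⟩
      simp only [Finset.mem_insert, Finset.mem_singleton] at hv ⊢
      tauto)
  have := hno D' h4 h5
  omega

/-- If all connected dominating sets have order at least `2 α - 1`, the end of an induced path of
odd order has a neighbour that is adjacent to no other vertex of the path. -/
lemma IsInducedPath.exists_private {G : SimpleGraph V} (hG : G.Connected)
    (hno : ∀ D, G.IsGrown D → G.IsDominating D → 2 * G.indepNum < D.card + 2)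
    {p : ℕ → V} {k : ℕ} (hk : 1 ≤ k) (h : G.IsInducedPath p (2 * k + 1)) :
    ∃ a, G.Adj a (p 0) ∧ ∀ i, 1 ≤ i → i < 2 * k + 1 → a ≠ p i ∧ ¬ G.Adj a (p i) := by
  by_contra! hcon
  obtain ⟨l, rfl⟩ : ∃ l, k = l + 1 := ⟨k - 1, by omega⟩
  have hp : G.IsInducedPath (fun i => p (i + 1)) (2 * l + 1 + 1) := h.shift
  obtain ⟨hS, hScard⟩ := h.isIndepSet_even
  have hmem : ∀ i, 1 ≤ i → i < 2 * (l + 1) + 1 →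
      p i ∈ (Finset.range (2 * l + 1 + 1)).image fun i => p (i + 1) := by
    intro i hi hi'
    refine Finset.mem_image.2 ⟨i - 1, Finset.mem_range.2 (by omega), ?_⟩
    rw [Nat.sub_add_cancel hi]
  have h01 : G.Adj (p 1) (p 0) := (h.adj_iff (by omega) (by omega)).2 (Or.inr rfl)
  -- Without a private neighbour, the path minus `p 0` still dominates all neighbours of `p 0`. It
  -- has 2k vertices against the k + 1 independent vertices at even positions, and 2k + 2 = 2(k +
  -- 1).
  obtain ⟨D', h4, h5, h6⟩ := hp.isGrown.exists_isDominating hG (s := 2) hS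
    (by rw [hp.card, hScard]; omega)
    (by
      intro v hv
      simp only [Finset.mem_image, Finset.mem_range] at hv
      obtain ⟨i, hi, rfl⟩ := hv
      rcases Nat.eq_zero_or_pos i with rfl | hi0
      · exact Or.inr ⟨p 1, hmem 1 le_rfl (by omega), h01⟩
      · exact Or.inl (hmem _ (by omega) (by omega)))
    (by
      intro v hv w hvw
      simp only [Finset.mem_image, Finset.mem_range] at hv
      obtain ⟨i, hi, rfl⟩ := hv
      rcases Nat.eq_zero_or_pos i with rfl | hi0
      · obtain ⟨i, hi, hi', h7⟩ := hcon w hvw.symm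
        by_cases hw : w = p i
        · exact Or.inl (hw ▸ hmem i hi hi')
        · exact Or.inr ⟨p i, hmem i hi hi', (h7 hw).symm⟩
      · exact Or.inr ⟨_, hmem _ (by omega) (by omega), hvw⟩)
  have := hno D' h4 h5
  omega

/-- Append private neighbours `a` and `b` at the two ends. If they were not adjacent, the result
would be an induced path of order 2k + 3, against `hmax`; so the edge `a b` closes a cycle. -/
lemma IsInducedPath.exists_isInducedCycle {G : SimpleGraph V} (hG : G.Connected)
    (hno : ∀ D, G.IsGrown D → G.IsDominating D → 2 * G.indepNum < D.card + 2)
    {p : ℕ → V} {k : ℕ} (hk : 1 ≤ k) (h : G.IsInducedPath p (2 * k + 1))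
    (hmax : ∀ q, ¬ G.IsInducedPath q (2 * k + 3)) :
    ∃ z : ZMod (2 * k + 3) → V, G.IsInducedCycle z := by
  obtain ⟨a, ha0, ha⟩ := h.exists_private hG hno hk
  obtain ⟨b, hb0, hb⟩ := h.reverse.exists_private hG hno hk
  simp only [Nat.sub_zero] at hb0
  replace hb : ∀ i < 2 * k, b ≠ p i ∧ ¬ G.Adj b (p i) := by
    intro i hi
    have := hb (2 * k - i) (by omega) (by omega)
    rwa [Nat.sub_sub_self hi.le] at this
  have hap0 : a ≠ p 0 := ha0.ne
  have hbp : b ≠ p (2 * k) := hb0.ne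
  have hab : a ≠ b := fun e => (hb 0 (by omega)).2 (e ▸ ha0)
  let q : ℕ → V := fun i => if i = 0 then a else if i = 2 * k + 2 then b else p (i - 1)
  have hq0 : q 0 = a := rfl
  have hqlast : q (2 * k + 2) = b := by simp [q]
  have hqmid : ∀ i, 0 < i → i < 2 * k + 2 → q i = p (i - 1) := by
    intro i h1 h2
    simp [q, h1.ne', h2.ne]
  have hcases : ∀ i < 2 * k + 3, i = 0 ∨ i = 2 * k + 2 ∨ (0 < i ∧ i < 2 * k + 2) := by omega
  have hap : ∀ i < 2 * k + 1, a ≠ p i := by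
    intro i hi
    rcases Nat.eq_zero_or_pos i with rfl | h1
    · exact hap0
    · exact (ha i h1 hi).1
  have hbp' : ∀ i < 2 * k + 1, b ≠ p i := by
    intro i hi
    rcases Nat.lt_succ_iff_lt_or_eq.1 hi with h1 | rfl
    · exact (hb i h1).1
    · exact hbp
  have haadj : ∀ i < 2 * k + 1, (G.Adj a (p i) ↔ i = 0) := by
    intro i hi
    rcases Nat.eq_zero_or_pos i with rfl | h1
    · simpa using ha0
    · simpa [h1.ne'] using (ha i h1 hi).2
  have hbadj : ∀ i < 2 * k + 1, (G.Adj b (p i) ↔ i = 2 * k) := by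
    intro i hi
    rcases Nat.lt_succ_iff_lt_or_eq.1 hi with h1 | rfl
    · simpa [h1.ne] using (hb i h1).2
    · simpa using hb0
  have hqinj : ∀ i < 2 * k + 3, ∀ j < 2 * k + 3, q i = q j → i = j := by
    intro i hi j hj hij
    rcases hcases i hi with rfl | rfl | ⟨hi1, hi2⟩ <;>
      rcases hcases j hj with rfl | rfl | ⟨hj1, hj2⟩
    · rfl
    · rw [hq0, hqlast] at hij
      exact absurd hij hab
    · rw [hq0, hqmid j hj1 hj2] at hij
      exact absurd hij (hap _ (by omega))
    · rw [hq0, hqlast] at hij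
      exact absurd hij.symm hab
    · rfl
    · rw [hqlast, hqmid j hj1 hj2] at hij
      exact absurd hij (hbp' _ (by omega))
    · rw [hq0, hqmid i hi1 hi2] at hij
      exact absurd hij.symm (hap _ (by omega))
    · rw [hqlast, hqmid i hi1 hi2] at hij
      exact absurd hij.symm (hbp' _ (by omega))
    · rw [hqmid i hi1 hi2, hqmid j hj1 hj2] at hij
      have := h.inj (by omega) (by omega) hij
      omega
  have hqadj : ∀ i < 2 * k + 3, ∀ j < 2 * k + 3, (G.Adj (q i) (q j) ↔ i + 1 = j ∨ j + 1 = i ∨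
      (G.Adj a b ∧ (i = 0 ∧ j = 2 * k + 2 ∨ j = 0 ∧ i = 2 * k + 2))) := by
    intro i hi j hj
    rcases hcases i hi with rfl | rfl | ⟨hi1, hi2⟩ <;>
      rcases hcases j hj with rfl | rfl | ⟨hj1, hj2⟩
    · simp
    · rw [hq0, hqlast]
      simp
    · rw [hq0, hqmid j hj1 hj2, haadj _ (by omega)]
      omega
    · rw [hq0, hqlast, G.adj_comm]
      simp
    · simp
    · rw [hqlast, hqmid j hj1 hj2, hbadj _ (by omega)]
      omega
    · rw [hq0, hqmid i hi1 hi2, G.adj_comm, haadj _ (by omega)]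
      omega
    · rw [hqlast, hqmid i hi1 hi2, G.adj_comm, hbadj _ (by omega)]
      omega
    · rw [hqmid i hi1 hi2, hqmid j hj1 hj2, h.adj_iff (by omega) (by omega)]
      omega
  have hadjab : G.Adj a b := by
    by_contra hnab
    refine hmax q ⟨fun i hi j hj => hqinj i hi j hj, fun i hi j hj => ?_⟩
    rw [hqadj i hi j hj]
    simp [hnab]
  have hsucc : ∀ i j : ZMod (2 * k + 3), j = i + 1 ↔
      i.val + 1 = j.val ∨ (i.val = 2 * k + 2 ∧ j.val = 0) := by
    intro i j
    have hi := ZMod.val_lt i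
    have hj := ZMod.val_lt j
    rcases Nat.lt_or_ge (i.val + 1) (2 * k + 3) with h1 | h1
    · have h2 : (i + 1).val = i.val + 1 := by
        rw [← ZMod.val_natCast_of_lt h1]
        simp
      rw [← (ZMod.val_injective _).eq_iff, h2]
      omega
    · have h2 : i + 1 = 0 := by
        have h3 : ((i.val + 1 : ℕ) : ZMod (2 * k + 3)) = ((2 * k + 3 : ℕ) : ZMod (2 * k + 3)) := by
          congr 1
          omega
        rw [ZMod.natCast_self] at h3
        simpa using h3
      rw [h2, ← ZMod.val_eq_zero]
      omega
  refine ⟨fun i => q i.val, fun i j hij => ZMod.val_injective _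
    (hqinj _ (ZMod.val_lt i) _ (ZMod.val_lt j) hij), fun i j => ?_⟩
  rw [hqadj _ (ZMod.val_lt i) _ (ZMod.val_lt j), hsucc, hsucc]
  simp only [hadjab, true_and]
  tauto

/-- An induced odd cycle that is longer than all induced paths of odd order is dominating. -/
lemma IsInducedCycle.isDominating {G : SimpleGraph V} (hG : G.Connected)
    (hno : ∀ D, G.IsGrown D → G.IsDominating D → 2 * G.indepNum < D.card + 2)
    {k : ℕ} (hk : 1 ≤ k) {z : ZMod (2 * k + 3) → V} (h : G.IsInducedCycle z)
    (hmax : ∀ q, ¬ G.IsInducedPath q (2 * k + 3)) :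
    G.IsDominating (Finset.univ.image z) := by
  by_contra hdom
  obtain ⟨d, hd, c, hc, u, hu, hdc, hcu, hDu⟩ := h.isGrown.exists_adj_adj hG hdom
  obtain ⟨s, _, rfl⟩ := Finset.mem_image.1 hd
  have hmem : ∀ i, z i ∈ Finset.univ.image z := fun i => Finset.mem_image_of_mem z (Finset.mem_univ i)
  have hcz : ∀ i, c ≠ z i := fun i e => hc (e ▸ hmem i)
  have huz : ∀ i, u ≠ z i := fun i e => hu (e ▸ hmem i)
  have huadj : ∀ i, ¬ G.Adj u (z i) := fun i e => hDu _ (hmem i) e.symm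
  have hnat : ∀ i j : ℕ, i < 2 * k + 3 → j < 2 * k + 3 → ((i : ZMod (2 * k + 3)) = j ↔ i = j) :=
    fun i j hi hj => ZMod.natCast_inj_of_lt hi hj
  have h02 : (2 : ZMod (2 * k + 3)) ≠ 0 := by
    have := (hnat 2 0 (by omega) (by omega)).not.2 (by omega)
    simpa using this
  have h01 : (1 : ZMod (2 * k + 3)) ≠ 0 := by
    have := (hnat 1 0 (by omega) (by omega)).not.2 (by omega)
    simpa using this
  have h03 : (3 : ZMod (2 * k + 3)) ≠ 0 := by
    have := (hnat 3 0 (by omega) (by omega)).not.2 (by omega)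
    simpa using this
  have hskip : ∀ i, ¬ G.Adj (z (i - 1)) (z (i + 1)) := by
    intro i
    rw [h.adj_iff, not_or]
    constructor
    · intro e
      exact h01 (by linear_combination e)
    · intro e
      exact h03 (by linear_combination -e)
  have hskip' : ∀ i, z (i - 1) ≠ z (i + 1) := fun i e => h02 (by linear_combination -h.inj e)
  -- The star at `z s` with leaves `z (s - 1)`, `z (s + 1)`, `c` is not an induced claw, so `c` has
  -- two consecutive neighbours on the cycle.
  obtain ⟨t, ht, ht'⟩ : ∃ t, G.Adj c (z t) ∧ G.Adj c (z (t + 1)) := by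
    have h1 : G.Adj (z s) (z (s - 1)) := by
      rw [h.adj_iff]
      right
      ring
    have h2 : G.Adj (z s) (z (s + 1)) := by
      rw [h.adj_iff]
      exact Or.inl rfl
    rcases adj_of_claw hG hno h1 h2 hdc (hskip' s) (hcz _).symm (hcz _).symm with h3 | h3 | h3
    · exact absurd h3 (hskip s)
    · exact ⟨s - 1, h3.symm, by rw [sub_add_cancel]; exact hdc.symm⟩
    · exact ⟨s, hdc.symm, h3.symm⟩
  -- Since `u` has no neighbour on the cycle, claws at `c` with leaf `u` force the cycle neighbours
  -- of `c` to be pairwise adjacent. The cycle has length at least 5, so it has no triangle and only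
  -- `t`, `t + 1` remain.
  have hpair : ∀ i j, G.Adj c (z i) → G.Adj c (z j) → i ≠ j → G.Adj (z i) (z j) := by
    intro i j hi hj hij
    rcases adj_of_claw hG hno hi hj hcu (h.inj.ne hij) (huz i).symm (huz j).symm with h1 | h1 | h1
    · exact h1
    · exact absurd h1.symm (huadj i)
    · exact absurd h1.symm (huadj j)
  have honly : ∀ i, G.Adj c (z i) → i = t ∨ i = t + 1 := by
    intro i hi
    by_contra! hne
    have h1 := hpair i t hi ht hne.1
    rw [h.adj_iff] at h1
    rcases h1 with h1 | h1
    · obtain rfl : i = t - 1 := by linear_combination -h1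
      exact hskip t (hpair _ _ hi ht' hne.2)
    · exact hne.2 h1
  -- The path u, c, z t, z (t - 1), ..., z (t - 2k) omits only `z (t + 1)` and `z (t + 2)`, so it is
  -- induced of order 2k + 3, against `hmax`.
  let q : ℕ → V := fun i => if i = 0 then u else if i = 1 then c else z (t - ((i - 2 : ℕ) : ZMod _))
  have hq0 : q 0 = u := rfl
  have hq1 : q 1 = c := rfl
  have hq2 : ∀ i, q (i + 2) = z (t - i) := fun i => by simp [q]
  have hcadj : ∀ i < 2 * k + 1, (G.Adj c (z (t - i)) ↔ i = 0) := by
    intro i hi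
    constructor
    · intro e
      rcases honly _ e with h1 | h1
      · have h2 : (i : ZMod (2 * k + 3)) = (0 : ℕ) := by
          push_cast
          linear_combination -h1
        exact (hnat _ _ (by omega) (by omega)).1 h2
      · have h2 : ((i + 1 : ℕ) : ZMod (2 * k + 3)) = (0 : ℕ) := by
          push_cast
          linear_combination -h1
        have := (hnat _ _ (by omega) (by omega)).1 h2
        omega
    · rintro rfl
      simpa using ht
  have hzadj : ∀ i j : ℕ, i < 2 * k + 1 → j < 2 * k + 1 →
      (G.Adj (z (t - i)) (z (t - j)) ↔ i + 1 = j ∨ j + 1 = i) := by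
    intro i j hi hj
    rw [h.adj_iff, ← hnat (i + 1) j (by omega) (by omega), ← hnat (j + 1) i (by omega) (by omega),
      or_comm]
    push_cast
    refine or_congr ⟨fun e => ?_, fun e => ?_⟩ ⟨fun e => ?_, fun e => ?_⟩
    · linear_combination -e
    · linear_combination -e
    · linear_combination -e
    · linear_combination -e
  have hzinj : ∀ i j : ℕ, i < 2 * k + 1 → j < 2 * k + 1 → z (t - i) = z (t - j) → i = j := by
    intro i j hi hj hij
    refine (hnat i j (by omega) (by omega)).1 ?_
    linear_combination -h.inj hij
  refine hmax q ⟨?_, ?_⟩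
  · rintro (_ | _ | i) hi (_ | _ | j) hj hij <;>
      simp only [zero_add, hq0, hq1, hq2, add_assoc, Nat.reduceAdd] at hij ⊢
    · exact absurd hij hcu.ne'
    · exact absurd hij (huz _)
    · exact absurd hij hcu.ne
    · exact absurd hij (hcz _)
    · exact absurd hij.symm (huz _)
    · exact absurd hij.symm (hcz _)
    · rw [hzinj i j (by omega) (by omega) hij]
  · rintro (_ | _ | i) hi (_ | _ | j) hj <;>
      simp only [zero_add, hq0, hq1, hq2, add_assoc, Nat.reduceAdd]
    · simp
    · simpa using hcu.symm
    · simpa using huadj _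
    · simpa using hcu
    · simp
    · rw [hcadj j (by omega)]
      omega
    · rw [G.adj_comm]
      simpa using huadj _
    · rw [G.adj_comm, hcadj i (by omega)]
      omega
    · rw [hzadj i j (by omega) (by omega)]
      omega

/-- If `α ≥ 2` and all connected dominating sets have order at least `2 α - 1`, there is a
dominating cycle of length at most `2 α + 1`. -/
lemma exists_isInducedCycle_isDominating {G : SimpleGraph V} (hG : G.Connected)
    (hno : ∀ D, G.IsGrown D → G.IsDominating D → 2 * G.indepNum < D.card + 2)
    (hα : 2 ≤ G.indepNum) :
    ∃ k : ℕ, ∃ z : ZMod (2 * k + 3) → V, G.IsInducedCycle z ∧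
      G.IsDominating (Finset.univ.image z) ∧ 2 * k + 3 ≤ 2 * G.indepNum + 1 := by
  obtain ⟨v⟩ := hG.nonempty
  have hP3 : ∃ p, G.IsInducedPath p (2 * 1 + 1) := by
    have hv : ¬ G.IsDominating {v} := by
      intro h1
      have := hno {v} (IsGrown.singleton v) h1
      rw [Finset.card_singleton] at this
      omega
    obtain ⟨d, hd, c, hc, u, hu, hdc, hcu, hDu⟩ := (IsGrown.singleton v).exists_adj_adj hG hv
    rw [Finset.mem_singleton] at hd hc hu
    subst hd
    have hdu : ¬ G.Adj d u := hDu d (Finset.mem_singleton_self d)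
    refine ⟨fun i => if i = 0 then d else if i = 1 then c else u, ?_, ?_⟩
    · rintro (_ | _ | _ | i) hi (_ | _ | _ | j) hj hij <;>
        first | omega | simp_all [hdc.ne, hcu.ne, eq_comm]
    · rintro (_ | _ | _ | i) hi (_ | _ | _ | j) hj <;>
        first | omega | simp_all [G.adj_comm]
  let P : ℕ → Prop := fun k => ∃ p, G.IsInducedPath p (2 * k + 1)
  have hbound : ∀ k, P k → k ≤ Fintype.card V := by
    rintro k ⟨p, hp⟩
    have := hp.card ▸ Finset.card_le_univ ((Finset.range (2 * k + 1)).image p)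
    omega
  classical
  set k := Nat.findGreatest P (Fintype.card V) with hk
  have hk1 : 1 ≤ k := Nat.le_findGreatest (hbound 1 hP3) hP3
  obtain ⟨p, hp⟩ : P k := Nat.findGreatest_spec (hbound 1 hP3) hP3
  have hmax : ∀ q, ¬ G.IsInducedPath q (2 * k + 3) := by
    intro q hq
    have h1 : P (k + 1) := ⟨q, hq⟩
    have := Nat.le_findGreatest (hbound _ h1) h1
    omega
  obtain ⟨z, hz⟩ := hp.exists_isInducedCycle hG hno hk1 hmax
  refine ⟨k, z, hz, hz.isDominating hG hno hk1 hmax, ?_⟩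
  -- The k + 1 vertices at even positions are independent, so k + 1 ≤ α and 2k + 3 ≤ 2α + 1.
  obtain ⟨hS, hcard⟩ := hp.isIndepSet_even
  have := hS.card_le_indepNum
  omega

end SimpleGraph

/-! ### The main theorem -/

open SimpleGraph in
theorem mainTheorem1 {V : Type*} [Fintype V] [DecidableEq V] (G : SimpleGraph V)
    (n α : ℕ) (hG : G.Connected) (hn : Fintype.card V = n) (hα : G.indepNum = α)
    (hα1 : 1 ≤ α) (hnα : 2 * α ≤ n) :
    ∃ T : SimpleGraph V, T ≤ G ∧ T.IsTree ∧
      (α ≤ 6 → T.averageDistance < (α : ℝ) + 1) ∧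
      (7 ≤ α → T.averageDistance < (α : ℝ) + 1 / 2 + 4 * ((α : ℝ) - 1) / (α : ℝ) ^ 2) := by
  subst hn hα
  have hV : 2 ≤ Fintype.card V := by omega
  have hαR : (1 : ℝ) ≤ G.indepNum := by exact_mod_cast hα1
  rcases le_or_gt G.indepNum 6 with h6 | h7
  · obtain ⟨v⟩ := hG.nonempty
    -- Starting from a single vertex, 1 + 1 = 2 · 1 gives order at most 2α - 1.
    obtain ⟨D, hD, hdom, hcard⟩ := (IsGrown.singleton v : G.IsGrown {v}).exists_isDominating hG
      (s := 1) (S := {v}) (by simp) (by simp) (fun w hw => Or.inl hw)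
      (fun w hw x hx => Or.inr ⟨w, hw, hx⟩)
    obtain ⟨T, hle, htree, hT⟩ := hD.exists_isTree_averageDistance_lt hdom hV
    refine ⟨T, hle, htree, fun _ => hT.trans_le ?_, fun h => absurd h (by omega)⟩
    have : (D.card : ℝ) + 1 ≤ 2 * G.indepNum := by exact_mod_cast hcard
    linarith
  · suffices ∃ T ≤ G, T.IsTree ∧ T.averageDistance < (G.indepNum : ℝ) + 1 / 2 by
      obtain ⟨T, hle, htree, hT⟩ := this
      refine ⟨T, hle, htree, fun h => absurd h (by omega), fun _ => hT.trans_le ?_⟩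
      have : 0 ≤ 4 * ((G.indepNum : ℝ) - 1) / (G.indepNum : ℝ) ^ 2 := by
        have : (0 : ℝ) ≤ G.indepNum - 1 := by linarith
        positivity
      linarith
    by_cases hsmall : ∃ D, G.IsGrown D ∧ G.IsDominating D ∧ D.card + 2 ≤ 2 * G.indepNum
    · obtain ⟨D, hD, hdom, hcard⟩ := hsmall
      obtain ⟨T, hle, htree, hT⟩ := hD.exists_isTree_averageDistance_lt hdom hV
      refine ⟨T, hle, htree, hT.trans_le ?_⟩
      have : (D.card : ℝ) + 2 ≤ 2 * G.indepNum := by exact_mod_cast hcard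
      linarith
    · push Not at hsmall
      obtain ⟨k, z, hz, hdom, hk⟩ := exists_isInducedCycle_isDominating hG hsmall (by omega)
      obtain ⟨T, hle, htree, hT⟩ := exists_isTree_averageDistance_lt_of_cycle (2 * k + 3) z hz.inj
        (fun i => (hz.adj_iff i (i + 1)).2 (Or.inl rfl)) hdom hV
      refine ⟨T, hle, htree, hT.trans_le ?_⟩
      have h1 : ((2 * k + 3 : ℕ) : ℝ) ≤ 2 * G.indepNum + 1 := by exact_mod_cast hk
      have h2 : (7 : ℝ) ≤ G.indepNum := by exact_mod_cast h7
      -- (2α + 1)/3 + 2 ≤ α + 1/2 holds as soon as α ≥ 11/2.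
      linarith
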